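/- For a compact set $E\subset\mathbb C$ let $\|f\|_E=\sup_{z\in E}|f(z)|$, and let $C_E$ denote the smallest constant $C>0$ such that $$\|q\|_E\le C^{\,n}\,\|p\|_E,\qquad n=\deg p,$$ holds for every monic polynomial $p$ with complex coefficients and every monic factor $q$ of $p$. For $E=[-a,a]$ with $a>0$ this smallest constant exists and $$C_{[-a,a]}=\begin{cases}\dfrac 2a, & 0<a\le \tfrac12,\\[2mm] \dfrac 2a\,\exp\left(\displaystyle\int_{1-a}^{a}\frac{\log(t+a)}{\pi\sqrt{a^2-t^2}}\,dt\right), & a>\tfrac12.\end{cases}$$ Moreover, for every $a>0$, $$C_{[-a,a]}=\frac2a\exp\left(\max_{u\in[-a,a]}\int_{[-a,a]\setminus(u-1,u+1)}\frac{\log|t-u|}{\pi\sqrt{a^2-t^2}}\,dt\right),$$ where the maximum is attained at both endpoints $u=-a$ and $u=a$ (all integrals converge absolutely). In particular, for $a=2$, $$C_{[-2,2]}=\exp\left(\int_0^{2/3}\log(2+2\cos \pi x)\,dx\right)=1.9081\ldots.$$ -/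

import Mathlib

open Set MeasureTheory
open scoped Polynomial

noncomputable section

/-- The uniform norm `‖p‖_E = sup_{z ∈ E} |p z|` of a polynomial on a set `E ⊆ ℂ`
(meant for nonempty bounded `E`). -/
def supNorm (E : Set ℂ) (p : ℂ[X]) : ℝ :=
  sSup ((fun z : ℂ => ‖p.eval z‖) '' E)

/-- `‖q‖_E ≤ C ^ n ‖p‖_E`, `n = deg p`, for every monic complex polynomial `p` and every
monic factor `q` of `p`. -/
def FactorInequality (E : Set ℂ) (C : ℝ) : Prop :=
  ∀ p q : ℂ[X], p.Monic → q.Monic → q ∣ p →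
    supNorm E q ≤ C ^ p.natDegree * supNorm E p

/-- `C` is the best (the smallest) positive constant in the inequality for a monic factor. -/
def IsBestFactorConstant (E : Set ℂ) (C : ℝ) : Prop :=
  IsLeast {C' : ℝ | 0 < C' ∧ FactorInequality E C'} C

/-- The real segment `[-a, a]` as a subset of the complex plane. -/
def realSegment (a : ℝ) : Set ℂ :=
  (fun x : ℝ => (x : ℂ)) '' Icc (-a) a

/-- The integrand `log |t - u| / (π √(a² - t²))`, i.e. `log |t - u|` times the arcsine density
of `[-a, a]`. -/
def arcsineLogIntegrand (a u t : ℝ) : ℝ :=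
  Real.log |t - u| / (Real.pi * Real.sqrt (a ^ 2 - t ^ 2))

/-- The integral of `log |t - u|` against the arcsine distribution of `[-a, a]` over the part
`[-a, a] \ (u - 1, u + 1)` of the segment at distance at least one from `u`. -/
def farLogIntegral (a u : ℝ) : ℝ :=
  ∫ t in Icc (-a) a \ Ioo (u - 1) (u + 1), arcsineLogIntegrand a u t

end

/-! Let `μ` be the arcsine (equilibrium) measure of `[-a, a]`, whose capacity is `a / 2`, and let
`g` be the Green function of the complement with pole at infinity. The quantity behind every formula
is `posLogPotential a u`, the integral of `log⁺ |u - t|` against `dμ(t)`.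

Upper bound: let `p = q s` be monic of degree `n`. Then `|q(u)|` is at most the Mahler measure of
`q(X + u)`, hence at most that of `p(X + u)`, since the monic `s` contributes a factor at least 1.
Averaging Bernstein–Walsh, `log |p| ≤ log ‖p‖ + n g`, over the unit circle about `u`, and evaluating
the mean of `g` by Fubini and Jensen, gives `|q(u)| ≤ (2 / a * exp (posLogPotential a u)) ^ n ‖p‖`
(`norm_eval_factor_le`).

Lower bound: for monic Chebyshev polynomials `‖p‖ ≤ 2 (a / 2) ^ n`. The factor `q` keeping the zeros
at distance at least 1 from `u` has `log |q(u)| / n` tending to `posLogPotential a u`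
(`le_of_factorInequality`).

It remains to maximize over `u` (`posLogPotential_le_right`). Near an endpoint monotonicity is
pointwise. Further inside, the potential of `μ` is constant on the segment, so only the mean of
`log⁺ (1 / |u - t|)` matters, and it grows with `|u|` because the arcsine density is even and
convex. -/

/-! ### The arcsine measure and the truncated logarithm. -/

section ArcsineMean

open Real

/-- The mean of `log⁺ |u - ·|` against the arcsine distribution of `[-a, a]`. -/
noncomputable def posLogPotential (a u : ℝ) : ℝ :=
  π⁻¹ * ∫ θ in (0 : ℝ)..π, log⁺ (u - a * cos θ)

theorem image_mul_cos_Ioo {a : ℝ} (ha : 0 < a) :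
    (fun θ => a * cos θ) '' Ioo 0 π = Ioo (-a) a := by
  ext t
  constructor
  · rintro ⟨θ, hθ, rfl⟩
    have h1 : cos θ < 1 := by
      simpa using cos_lt_cos_of_nonneg_of_le_pi le_rfl hθ.2.le hθ.1
    have h2 : -1 < cos θ := by
      simpa using cos_lt_cos_of_nonneg_of_le_pi hθ.1.le le_rfl hθ.2
    constructor <;> dsimp only <;> nlinarith
  · rintro ⟨h1, h2⟩
    have h3 : -1 < t / a := by rw [lt_div_iff₀ ha]; linarith
    have h4 : t / a < 1 := by rw [div_lt_iff₀ ha]; linarith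
    refine ⟨arccos (t / a), ⟨arccos_pos.2 h4, ?_⟩, ?_⟩
    · refine lt_of_le_of_ne (arccos_le_pi _) fun h => ?_
      rw [arccos_eq_pi] at h
      linarith
    · dsimp only
      rw [cos_arccos h3.le h4.le]
      field_simp

theorem injOn_mul_cos_Ioo {a : ℝ} (ha : 0 < a) : InjOn (fun θ => a * cos θ) (Ioo 0 π) := by
  intro x hx y hy hxy
  exact injOn_cos (Ioo_subset_Icc_self hx) (Ioo_subset_Icc_self hy)
    (mul_left_cancel₀ ha.ne' hxy)

/-- Under `t = a cos θ` the Jacobian `a sin θ` cancels `√(a² - t²)`, so the arcsine measure becomes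
uniform in `θ`. -/
theorem abs_deriv_smul_arcsine_density {a : ℝ} (ha : 0 < a) (g : ℝ → ℝ) {θ : ℝ}
    (hθ : θ ∈ Ioo 0 π) :
    |a * -sin θ| • (g (a * cos θ) / (π * √(a ^ 2 - (a * cos θ) ^ 2))) = π⁻¹ * g (a * cos θ) := by
  have hs : 0 < sin θ := sin_pos_of_pos_of_lt_pi hθ.1 hθ.2
  have h1 : a ^ 2 - (a * cos θ) ^ 2 = (a * sin θ) ^ 2 := by
    have := sin_sq_add_cos_sq θ
    linear_combination -a ^ 2 * this
  rw [h1, sqrt_sq (by positivity), mul_neg, abs_neg, abs_of_pos (by positivity), smul_eq_mul]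
  field_simp

theorem integrableOn_arcsine_iff {a : ℝ} (ha : 0 < a) (g : ℝ → ℝ) :
    IntegrableOn (fun t => g t / (π * √(a ^ 2 - t ^ 2))) (Icc (-a) a) ↔
      IntegrableOn (fun θ => g (a * cos θ)) (Ioo 0 π) := by
  rw [integrableOn_Icc_iff_integrableOn_Ioo, ← image_mul_cos_Ioo ha,
    integrableOn_image_iff_integrableOn_abs_deriv_smul measurableSet_Ioo
      (fun x _ => ((hasDerivAt_cos x).const_mul a).hasDerivWithinAt) (injOn_mul_cos_Ioo ha),
    integrableOn_congr_fun (fun θ hθ => abs_deriv_smul_arcsine_density ha g hθ) measurableSet_Ioo]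
  exact integrable_const_mul_iff (by simp [pi_ne_zero]) _

theorem setIntegral_arcsine {a : ℝ} (ha : 0 < a) (g : ℝ → ℝ) :
    ∫ t in Icc (-a) a, g t / (π * √(a ^ 2 - t ^ 2)) =
      π⁻¹ * ∫ θ in (0 : ℝ)..π, g (a * cos θ) := by
  rw [integral_Icc_eq_integral_Ioo, ← image_mul_cos_Ioo ha,
    integral_image_eq_integral_abs_deriv_smul measurableSet_Ioo
      (fun x _ => ((hasDerivAt_cos x).const_mul a).hasDerivWithinAt) (injOn_mul_cos_Ioo ha),
    setIntegral_congr_fun measurableSet_Ioo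
      (fun θ hθ => abs_deriv_smul_arcsine_density ha g hθ),
    intervalIntegral.integral_of_le pi_pos.le, integral_Ioc_eq_integral_Ioo, integral_const_mul]

/-- Cutting out the points at distance less than 1 is exactly the truncation of `log` to `log⁺`;
this turns `farLogIntegral` into a mean of a continuous function. -/
theorem indicator_compl_Ioo_log_abs (u t : ℝ) :
    (Ioo (u - 1) (u + 1))ᶜ.indicator (fun t => log |t - u|) t = log⁺ (u - t) := by
  have hab : |t - u| = |u - t| := abs_sub_comm _ _
  by_cases h : t ∈ Ioo (u - 1) (u + 1)
  · rw [indicator_of_notMem (by simpa using h), eq_comm, posLog_eq_zero_iff, abs_le]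
    constructor <;> linarith [h.1, h.2]
  · rw [indicator_of_mem h, hab, log_abs, posLog_eq_log]
    by_contra! h1
    rw [abs_lt] at h1
    exact h ⟨by linarith, by linarith⟩

theorem indicator_arcsineLogIntegrand (a u : ℝ) :
    (Ioo (u - 1) (u + 1))ᶜ.indicator (arcsineLogIntegrand a u) =
      fun t => log⁺ (u - t) / (π * √(a ^ 2 - t ^ 2)) := by
  ext t
  rw [← indicator_compl_Ioo_log_abs u t]
  simp only [indicator_apply]
  split_ifs <;> simp [arcsineLogIntegrand]

theorem continuous_posLog_sub_mul_cos (a u : ℝ) : Continuous fun θ => log⁺ (u - a * cos θ) :=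
  continuous_posLog.comp (by fun_prop)

theorem integrableOn_arcsineLogIntegrand {a : ℝ} (ha : 0 < a) (u : ℝ) :
    IntegrableOn (arcsineLogIntegrand a u) (Icc (-a) a \ Ioo (u - 1) (u + 1)) := by
  rw [sdiff_eq, inter_comm, IntegrableOn, ← Measure.restrict_restrict measurableSet_Ioo.compl,
    ← IntegrableOn, ← integrable_indicator_iff measurableSet_Ioo.compl,
    indicator_arcsineLogIntegrand]
  refine (integrableOn_arcsine_iff ha fun t => log⁺ (u - t)).2 ?_
  exact ((continuous_posLog_sub_mul_cos a u).integrableOn_Icc).mono_set Ioo_subset_Icc_self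

theorem farLogIntegral_eq_posLogPotential {a : ℝ} (ha : 0 < a) (u : ℝ) :
    farLogIntegral a u = posLogPotential a u := by
  rw [farLogIntegral, sdiff_eq, ← setIntegral_indicator measurableSet_Ioo.compl,
    indicator_arcsineLogIntegrand, posLogPotential]
  exact setIntegral_arcsine ha fun t => log⁺ (u - t)

theorem posLogPotential_neg (a u : ℝ) : posLogPotential a (-u) = posLogPotential a u := by
  unfold posLogPotential
  congr 1
  have h := intervalIntegral.integral_comp_sub_left (a := 0) (b := π)
    (fun θ => log⁺ (u - a * cos θ)) π
  simp only [sub_self, sub_zero, cos_pi_sub] at h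
  rw [← h]
  congr! 2 with θ
  rw [← posLog_neg]
  ring_nf

theorem integral_comp_cos_zero_two_pi {f : ℝ → ℝ}
    (hf : IntervalIntegrable (fun θ => f (cos θ)) volume 0 π) :
    ∫ θ in (0 : ℝ)..2 * π, f (cos θ) = 2 * ∫ θ in (0 : ℝ)..π, f (cos θ) := by
  have h1 : (fun θ => f (cos (2 * π - θ))) = fun θ => f (cos θ) := by
    ext θ; rw [cos_two_pi_sub]
  have h2 : ∫ θ in π..2 * π, f (cos θ) = ∫ θ in (0 : ℝ)..π, f (cos θ) := by
    have := intervalIntegral.integral_comp_sub_left (a := 0) (b := π) (fun θ => f (cos θ)) (2 * π)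
    rw [h1] at this
    rw [this]; congr 1 <;> ring
  have h3 : IntervalIntegrable (fun θ => f (cos θ)) volume π (2 * π) := by
    have := (hf.comp_sub_left (2 * π)).symm
    rw [h1] at this
    convert this using 1 <;> ring
  rw [← intervalIntegral.integral_add_adjacent_intervals hf h3, h2]; ring

theorem intervalIntegrable_comp_cos_of_two_pi {f : ℝ → ℝ}
    (hf : IntervalIntegrable (fun θ => f (cos θ)) volume 0 (2 * π)) :
    IntervalIntegrable (fun θ => f (cos θ)) volume 0 π := by
  refine hf.mono_set ?_
  rw [uIcc_of_le pi_pos.le, uIcc_of_le two_pi_pos.le]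
  exact Icc_subset_Icc_right (by linarith [pi_pos])

end ArcsineMean

/-! ### The Green function of the segment and the Bernstein–Walsh inequality. -/

section GreenFunction

open Real

/-- The Green function of the complement of `[-a, a]` with pole at infinity, written as the
logarithmic potential of the arcsine distribution minus the logarithm of the capacity. -/
noncomputable def segmentGreen (a : ℝ) (z : ℂ) : ℝ :=
  circleAverage (fun ξ : ℂ => log ‖z - a / 2 * (ξ + ξ⁻¹)‖) 0 1 - log (a / 2)

theorem exists_eq_joukowski {a : ℝ} (ha : 0 < a) (z : ℂ) :
    ∃ w : ℂ, w ≠ 0 ∧ ‖w‖ ≤ 1 ∧ z = a / 2 * (w + w⁻¹) := by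
  have ha' : (a : ℂ) ≠ 0 := by exact_mod_cast ha.ne'
  -- The two solutions of the quadratic equation for `w` are `(z ± s) / a`. They are mutually
  -- inverse, so one of them lies in the closed unit disc.
  obtain ⟨s, hs⟩ := IsAlgClosed.exists_pow_nat_eq (z ^ 2 - a ^ 2 : ℂ) (n := 2) (by norm_num)
  have key : (z + s) * (z - s) = a ^ 2 := by linear_combination -hs
  have h1 : z + s ≠ 0 := fun h => by
    rw [h, zero_mul] at key; exact pow_ne_zero 2 ha' key.symm
  set w : ℂ := (z + s) / a with hw
  have hw0 : w ≠ 0 := div_ne_zero h1 ha'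
  have hinv : w⁻¹ = (z - s) / a := by
    rw [hw, inv_div, div_eq_div_iff h1 ha']
    linear_combination -key
  have hz : z = a / 2 * (w + w⁻¹) := by
    rw [hinv, hw]; field_simp; ring
  rcases le_total ‖w‖ 1 with h | h
  · exact ⟨w, hw0, h, hz⟩
  · exact ⟨w⁻¹, inv_ne_zero hw0, by rw [norm_inv]; exact inv_le_one_of_one_le₀ h,
      by rw [inv_inv, add_comm]; exact hz⟩

theorem circleIntegrable_log_norm_sub_joukowski (a : ℝ) (z : ℂ) :
    CircleIntegrable (fun ξ : ℂ => log ‖z - a / 2 * (ξ + ξ⁻¹)‖) 0 1 := by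
  have h : MeromorphicOn (fun ξ : ℂ => z - a / 2 * (ξ + ξ⁻¹)) (Metric.sphere 0 |1|) := by
    intro x _
    fun_prop
  exact h.circleIntegrable_log_norm

theorem log_norm_joukowski_sub {a : ℝ} (ha : 0 < a) {w ξ : ℂ} (hw : w ≠ 0) (hξ : ‖ξ‖ = 1)
    (h1 : ξ ≠ w) (h2 : ξ ≠ w⁻¹) :
    log ‖(a / 2 * (w + w⁻¹) : ℂ) - a / 2 * (ξ + ξ⁻¹)‖ =
      log (a / 2) + (log ‖ξ - w‖ + log ‖ξ - w⁻¹‖) := by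
  have hξ0 : ξ ≠ 0 := by rintro rfl; simp at hξ
  have e : (a / 2 * (w + w⁻¹) : ℂ) - a / 2 * (ξ + ξ⁻¹) =
      -((a / 2 : ℝ) : ℂ) * ((ξ - w) * (ξ - w⁻¹)) / ξ := by
    push_cast; field_simp; ring
  have n1 : ‖ξ - w‖ ≠ 0 := norm_ne_zero_iff.2 (sub_ne_zero.2 h1)
  have n2 : ‖ξ - w⁻¹‖ ≠ 0 := norm_ne_zero_iff.2 (sub_ne_zero.2 h2)
  rw [e, norm_div, hξ, div_one, norm_mul, norm_neg, norm_mul, Complex.norm_real,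
    Real.norm_of_nonneg (by positivity), log_mul (by positivity) (mul_ne_zero n1 n2),
    log_mul n1 n2]

theorem circleAverage_log_norm_joukowski_sub {a : ℝ} (ha : 0 < a) {w : ℂ} (hw : w ≠ 0) :
    circleAverage (fun ξ : ℂ => log ‖(a / 2 * (w + w⁻¹) : ℂ) - a / 2 * (ξ + ξ⁻¹)‖) 0 1 =
      log (a / 2) + (log⁺ ‖w‖ + log⁺ ‖w⁻¹‖) := by
  have i1 := circleIntegrable_log_norm_sub_const (a := w) (c := 0) 1
  have i2 := circleIntegrable_log_norm_sub_const (a := w⁻¹) (c := 0) 1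
  have h : circleAverage (fun ξ : ℂ => log ‖(a / 2 * (w + w⁻¹) : ℂ) - a / 2 * (ξ + ξ⁻¹)‖) 0 1 =
      circleAverage (fun ξ : ℂ => log (a / 2) + (log ‖ξ - w‖ + log ‖ξ - w⁻¹‖)) 0 1 := by
    unfold circleAverage
    congr 1
    apply intervalIntegral.integral_congr_ae
    -- The factorization of the logarithm fails at the zeros `ξ = w, w⁻¹`, since `log 0 = 0`; they
    -- occupy only countably many angles.
    have hc : (circleMap 0 1 ⁻¹' {w, w⁻¹}).Countable :=
      ((countable_singleton w⁻¹).insert w).preimage_circleMap 0 one_ne_zero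
    filter_upwards [compl_mem_ae_iff.2 (hc.measure_zero volume)] with θ hθ _
    simp only [mem_compl_iff, mem_preimage, mem_insert_iff, mem_singleton_iff, not_or] at hθ
    exact log_norm_joukowski_sub ha hw (by simp) hθ.1 hθ.2
  rw [h, circleAverage_fun_add (f₂ := fun ξ : ℂ => log ‖ξ - w‖ + log ‖ξ - w⁻¹‖)
      (circleIntegrable_const _ _ _) (i1.add i2),
    circleAverage_fun_add i1 i2, circleAverage_const, circleAverage_log_norm_sub_const_eq_posLog,
    circleAverage_log_norm_sub_const_eq_posLog]

theorem segmentGreen_joukowski {a : ℝ} (ha : 0 < a) {w : ℂ} (hw : w ≠ 0) (h1 : ‖w‖ ≤ 1) :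
    segmentGreen a (a / 2 * (w + w⁻¹)) = -log ‖w‖ := by
  have h2 : log⁺ ‖w‖ = 0 := by rw [posLog_eq_zero_iff, abs_norm]; exact h1
  have h3 := posLog_sub_posLog_inv (x := ‖w‖)
  rw [segmentGreen, circleAverage_log_norm_joukowski_sub ha hw, norm_inv]
  linarith

theorem joukowski_mem_realSegment {a : ℝ} (ha : 0 < a) {ξ : ℂ} (hξ : ‖ξ‖ = 1) :
    (a / 2 * (ξ + ξ⁻¹) : ℂ) ∈ realSegment a := by
  have h : ξ + ξ⁻¹ = ((2 * ξ.re : ℝ) : ℂ) := by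
    rw [Complex.inv_eq_conj hξ, Complex.add_conj]
  have hre := abs_le.1 ((Complex.abs_re_le_norm ξ).trans hξ.le)
  refine ⟨a * ξ.re, ⟨by nlinarith, by nlinarith⟩, ?_⟩
  rw [h]; push_cast; ring

theorem joukowski_circleMap (a θ : ℝ) :
    (a / 2 * (circleMap 0 1 θ + (circleMap 0 1 θ)⁻¹) : ℂ) = ((a * cos θ : ℝ) : ℂ) := by
  have h : circleMap 0 1 θ + (circleMap 0 1 θ)⁻¹ = ((2 * cos θ : ℝ) : ℂ) := by
    rw [Complex.inv_eq_conj (by simp), Complex.add_conj]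
    congr 2
    simp [circleMap, Complex.exp_ofReal_mul_I_re]
  rw [h]; push_cast; ring

theorem bddAbove_norm_eval_realSegment (a : ℝ) (p : ℂ[X]) :
    BddAbove ((fun z : ℂ => ‖p.eval z‖) '' realSegment a) := by
  refine IsCompact.bddAbove_image ?_ (by fun_prop)
  exact isCompact_Icc.image Complex.continuous_ofReal

theorem norm_eval_le_supNorm {a : ℝ} (p : ℂ[X]) {z : ℂ} (hz : z ∈ realSegment a) :
    ‖p.eval z‖ ≤ supNorm (realSegment a) p :=
  le_csSup (bddAbove_norm_eval_realSegment a p) (mem_image_of_mem _ hz)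

theorem supNorm_nonneg (E : Set ℂ) (p : ℂ[X]) : 0 ≤ supNorm E p :=
  Real.sSup_nonneg (by rintro _ ⟨z, _, rfl⟩; exact norm_nonneg _)

theorem exists_supNorm_eq {a : ℝ} (ha : 0 < a) (p : ℂ[X]) :
    ∃ u ∈ Icc (-a) a, supNorm (realSegment a) p = ‖p.eval (u : ℂ)‖ := by
  have hc : IsCompact (realSegment a) := isCompact_Icc.image Complex.continuous_ofReal
  have hne : (realSegment a).Nonempty := ⟨0, 0, ⟨by linarith, ha.le⟩, by simp⟩
  obtain ⟨z, ⟨u, hu, rfl⟩, hz⟩ := hc.exists_sSup_image_eq hne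
    (f := fun z : ℂ => ‖p.eval z‖) (by fun_prop)
  exact ⟨u, hu, hz⟩

theorem supNorm_pos {a : ℝ} (ha : 0 < a) {p : ℂ[X]} (hp : p ≠ 0) :
    0 < supNorm (realSegment a) p := by
  refine (supNorm_nonneg _ _).lt_of_ne fun h => hp ?_
  refine Polynomial.eq_zero_of_infinite_isRoot p
    (((Icc_infinite (by linarith : -a < a)).image
      (Complex.ofReal_injective.injOn)).mono ?_)
  intro z hz
  exact norm_le_zero_iff.1 ((norm_eval_le_supNorm p hz).trans h.symm.le)

/-- Multiplying `p (a / 2 * (ζ + ζ⁻¹))` by `ζ ^ deg p` gives a polynomial in `ζ`. -/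
theorem exists_eval_eq_pow_mul_eval_joukowski (a : ℝ) (p : ℂ[X]) :
    ∃ P : ℂ[X], ∀ ζ : ℂ, ζ ≠ 0 →
      P.eval ζ = ζ ^ p.natDegree * p.eval (a / 2 * (ζ + ζ⁻¹)) := by
  refine ⟨∑ i ∈ Finset.range (p.natDegree + 1), Polynomial.C (p.coeff i) *
    (Polynomial.X ^ (p.natDegree - i) *
      (Polynomial.C (a / 2 : ℂ) * (Polynomial.X ^ 2 + 1)) ^ i), fun ζ hζ => ?_⟩
  rw [Polynomial.eval_eq_sum_range (p := p), Polynomial.eval_finsetSum, Finset.mul_sum]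
  refine Finset.sum_congr rfl fun i hi => ?_
  have hi' : i ≤ p.natDegree := Nat.lt_succ_iff.1 (Finset.mem_range.1 hi)
  simp only [Polynomial.eval_mul, Polynomial.eval_C, Polynomial.eval_pow, Polynomial.eval_X,
    Polynomial.eval_add, Polynomial.eval_one]
  have e : (a / 2 : ℂ) * (ζ ^ 2 + 1) = ζ * (a / 2 * (ζ + ζ⁻¹)) := by field_simp
  rw [e, mul_pow, ← Nat.sub_add_cancel hi', pow_add ζ (p.natDegree - i) i, Nat.sub_add_cancel hi']
  ring

/-- The Bernstein--Walsh inequality for a segment. -/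
theorem norm_pow_mul_norm_eval_joukowski_le {a : ℝ} (ha : 0 < a) (p : ℂ[X]) {w : ℂ}
    (hw : w ≠ 0) (h1 : ‖w‖ ≤ 1) :
    ‖w‖ ^ p.natDegree * ‖p.eval (a / 2 * (w + w⁻¹))‖ ≤ supNorm (realSegment a) p := by
  obtain ⟨P, hP⟩ := exists_eval_eq_pow_mul_eval_joukowski a p
  rw [← norm_pow, ← norm_mul, ← hP w hw]
  -- Maximum principle in the unit disc: the Joukowski map sends the unit circle into the segment,
  -- where `p` is bounded by its norm.
  refine Complex.norm_le_of_forall_mem_frontier_norm_le (f := fun z => P.eval z)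
    (U := Metric.ball 0 1) Metric.isBounded_ball P.differentiable.diffContOnCl (fun z hz => ?_) ?_
  · rw [frontier_ball _ one_ne_zero, mem_sphere_zero_iff_norm] at hz
    have hz0 : z ≠ 0 := by rintro rfl; simp at hz
    rw [hP z hz0, norm_mul, norm_pow, hz, one_pow, one_mul]
    exact norm_eval_le_supNorm p (joukowski_mem_realSegment ha hz)
  · rw [closure_ball _ one_ne_zero]
    simpa using h1

theorem log_norm_eval_le {a : ℝ} (ha : 0 < a) (p : ℂ[X]) {z : ℂ} (hz : p.eval z ≠ 0) :
    log ‖p.eval z‖ ≤ log (supNorm (realSegment a) p) + p.natDegree * segmentGreen a z := by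
  obtain ⟨w, hw, h1, rfl⟩ := exists_eq_joukowski ha z
  rw [segmentGreen_joukowski ha hw h1]
  have h := norm_pow_mul_norm_eval_joukowski_le ha p hw h1
  have hw' : 0 < ‖w‖ := norm_pos_iff.2 hw
  have hp' := norm_pos_iff.2 hz
  have h2 := log_le_log (by positivity) h
  rw [log_mul (by positivity) hp'.ne', log_pow] at h2
  linarith

end GreenFunction

/-! ### Upper bound by Mahler measure and Jensen's formula. -/

section UpperBound

open Real

theorem norm_circleMap_sub_joukowski (a u θ φ : ℝ) :
    ‖(circleMap 0 1 θ + u : ℂ) - a / 2 * (circleMap 0 1 φ + (circleMap 0 1 φ)⁻¹)‖ =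
      ‖circleMap 0 1 θ - ((a * cos φ - u : ℝ) : ℂ)‖ := by
  rw [joukowski_circleMap]
  congr 1
  push_cast; ring

theorem integral_log_norm_circleMap_sub (c : ℂ) :
    ∫ θ in (0 : ℝ)..2 * π, log ‖circleMap 0 1 θ - c‖ = 2 * π * log⁺ ‖c‖ := by
  have h := circleAverage_log_norm_sub_const_eq_posLog (a := c)
  rw [circleAverage_def, smul_eq_mul] at h
  rw [← h]
  field_simp [pi_ne_zero]

theorem intervalIntegrable_log_norm_circleMap_sub (c : ℂ) :
    IntervalIntegrable (fun θ => log ‖circleMap 0 1 θ - c‖) volume 0 (2 * π) :=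
  circleIntegrable_log_norm_sub_const (a := c) (c := 0) 1

theorem integral_abs_log_norm_circleMap_sub (c : ℂ) :
    ∫ θ in (0 : ℝ)..2 * π, ‖log ‖circleMap 0 1 θ - c‖‖ =
      2 * (∫ θ in (0 : ℝ)..2 * π, log⁺ ‖circleMap 0 1 θ - c‖) - 2 * π * log⁺ ‖c‖ := by
  have hc : Continuous fun θ : ℝ => log⁺ ‖circleMap 0 1 θ - c‖ :=
    continuous_posLog.comp (by fun_prop)
  rw [← integral_log_norm_circleMap_sub, ← intervalIntegral.integral_const_mul,
    ← intervalIntegral.integral_sub ((hc.intervalIntegrable _ _).const_mul 2)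
      (intervalIntegrable_log_norm_circleMap_sub c)]
  refine intervalIntegral.integral_congr fun θ _ => ?_
  have := half_mul_log_add_log_abs (x := ‖circleMap 0 1 θ - c‖)
  simp only [Real.norm_eq_abs]
  linarith

/-- Needed for Fubini despite the logarithmic singularities: `|log| = 2 log⁺ - log`, where the first
term is continuous and the second has its integral given by Jensen. -/
theorem continuous_integral_abs_log_norm_circleMap_sub {f : ℝ → ℂ} (hf : Continuous f) :
    Continuous fun φ => ∫ θ in (0 : ℝ)..2 * π, ‖log ‖circleMap 0 1 θ - f φ‖‖ := by
  simp only [integral_abs_log_norm_circleMap_sub]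
  refine Continuous.sub (Continuous.mul continuous_const ?_)
    (Continuous.mul continuous_const (continuous_posLog.comp hf.norm))
  refine intervalIntegral.continuous_parametric_intervalIntegral_of_continuous' ?_ _ _
  exact continuous_posLog.comp (by fun_prop)

theorem integrable_prod_log_norm_circleMap_sub {f : ℝ → ℂ} (hf : Continuous f) :
    Integrable (fun x : ℝ × ℝ => log ‖circleMap 0 1 x.1 - f x.2‖)
      ((volume.restrict (Ioc 0 (2 * π))).prod (volume.restrict (Ioc 0 (2 * π)))) := by
  have hm : Measurable fun x : ℝ × ℝ => log ‖circleMap 0 1 x.1 - f x.2‖ := by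
    refine measurable_log.comp (Continuous.measurable ?_)
    fun_prop
  rw [integrable_prod_iff' hm.aestronglyMeasurable]
  constructor
  · refine Filter.Eventually.of_forall fun φ => ?_
    exact (intervalIntegrable_iff_integrableOn_Ioc_of_le two_pi_pos.le).1
      (intervalIntegrable_log_norm_circleMap_sub (f φ))
  · have := (continuous_integral_abs_log_norm_circleMap_sub hf).integrableOn_Icc
      (a := 0) (b := 2 * π) (μ := volume)
    simp only [intervalIntegral.integral_of_le two_pi_pos.le] at this
    exact this.mono_set Ioc_subset_Icc_self

theorem segmentGreen_circleMap_add (a u θ : ℝ) :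
    segmentGreen a (circleMap 0 1 θ + u) =
      (2 * π)⁻¹ * (∫ φ in Ioc 0 (2 * π), log ‖circleMap 0 1 θ - ((a * cos φ - u : ℝ) : ℂ)‖) -
        log (a / 2) := by
  rw [segmentGreen, circleAverage_def, smul_eq_mul, intervalIntegral.integral_of_le two_pi_pos.le]
  simp only [norm_circleMap_sub_joukowski]

theorem integrableOn_segmentGreen_circleMap_add (a u : ℝ) :
    IntegrableOn (fun θ => segmentGreen a (circleMap 0 1 θ + u)) (Ioc 0 (2 * π)) := by
  simp only [segmentGreen_circleMap_add]
  have h := (integrable_prod_log_norm_circleMap_sub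
    (f := fun φ => ((a * cos φ - u : ℝ) : ℂ)) (by fun_prop)).integral_prod_left
  exact (h.const_mul _).sub (integrable_const _)

theorem integral_posLog_norm_two_pi (a u : ℝ) :
    (2 * π)⁻¹ * ∫ φ in (0 : ℝ)..2 * π, log⁺ ‖((a * cos φ - u : ℝ) : ℂ)‖ =
      posLogPotential a u := by
  have h : ∀ φ : ℝ, log⁺ ‖((a * cos φ - u : ℝ) : ℂ)‖ = log⁺ (u - a * cos φ) := fun φ => by
    rw [Complex.norm_real, Real.norm_eq_abs, posLog_abs, ← posLog_neg, neg_sub]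
  simp only [h]
  rw [integral_comp_cos_zero_two_pi (f := fun x => log⁺ (u - a * x))
    ((continuous_posLog_sub_mul_cos a u).intervalIntegrable _ _), posLogPotential]
  field_simp

/-- After swapping the two integrals, Jensen turns the circle mean of `log |ζ - c|` into `log⁺ |c|`.
This is where the cutoff at distance 1 comes from. -/
theorem circleAverage_segmentGreen (a u : ℝ) :
    circleAverage (fun ζ => segmentGreen a (ζ + u)) 0 1 =
      posLogPotential a u - log (a / 2) := by
  have hI := integrable_prod_log_norm_circleMap_sub
    (f := fun φ => ((a * cos φ - u : ℝ) : ℂ)) (by fun_prop)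
  have hs := integral_integral_swap
    (f := fun θ φ => log ‖circleMap 0 1 θ - ((a * cos φ - u : ℝ) : ℂ)‖) hI
  rw [circleAverage_def, smul_eq_mul, intervalIntegral.integral_of_le two_pi_pos.le]
  simp only [segmentGreen_circleMap_add]
  rw [integral_sub (hI.integral_prod_left.const_mul _) (integrable_const _), integral_const_mul,
    hs, setIntegral_const]
  simp only [← intervalIntegral.integral_of_le two_pi_pos.le, integral_log_norm_circleMap_sub]
  rw [intervalIntegral.integral_const_mul, ← integral_posLog_norm_two_pi]
  simp only [measureReal_def, volume_Ioc, sub_zero, ENNReal.toReal_ofReal two_pi_pos.le,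
    smul_eq_mul]
  field_simp

theorem logMahlerMeasure_comp_X_add_C_le {a : ℝ} (ha : 0 < a) {p : ℂ[X]} (hp : p ≠ 0) (u : ℝ) :
    (p.comp (Polynomial.X + Polynomial.C (u : ℂ))).logMahlerMeasure ≤
      log (supNorm (realSegment a) p) + p.natDegree * (posLogPotential a u - log (a / 2)) := by
  rw [← circleAverage_segmentGreen, Polynomial.logMahlerMeasure_def]
  have hG := (intervalIntegrable_iff_integrableOn_Ioc_of_le two_pi_pos.le).2
    (integrableOn_segmentGreen_circleMap_add a u)
  have hP := (p.comp (Polynomial.X + Polynomial.C (u : ℂ))).intervalIntegrable_mahlerMeasure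
  simp only [Polynomial.eval_comp, Polynomial.eval_add, Polynomial.eval_X, Polynomial.eval_C]
    at hP ⊢
  have hE : log (supNorm (realSegment a) p) +
      p.natDegree * circleAverage (fun ζ => segmentGreen a (ζ + u)) 0 1 =
      (2 * π)⁻¹ * ∫ θ in (0 : ℝ)..2 * π, (log (supNorm (realSegment a) p) +
        p.natDegree * segmentGreen a (circleMap 0 1 θ + u)) := by
    rw [intervalIntegral.integral_add intervalIntegrable_const (hG.const_mul _),
      intervalIntegral.integral_const_mul, intervalIntegral.integral_const, circleAverage_def]
    simp only [smul_eq_mul, sub_zero]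
    field_simp
  rw [hE, circleAverage_def, smul_eq_mul]
  refine mul_le_mul_of_nonneg_left ?_ (by positivity)
  refine intervalIntegral.integral_mono_ae two_pi_pos.le hP
    (intervalIntegrable_const.add (hG.const_mul _)) ?_
  -- The pointwise bound is available only off the zeros of `p`, again because `log 0 = 0`.
  have hc : (circleMap (u : ℂ) 1 ⁻¹' (p.roots.toFinset : Set ℂ)).Countable :=
    (Finset.countable_toSet _).preimage_circleMap _ one_ne_zero
  filter_upwards [compl_mem_ae_iff.2 (hc.measure_zero volume)] with θ hθ
  refine log_norm_eval_le ha p fun h0 => hθ ?_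
  simp only [mem_preimage, Finset.mem_coe, Multiset.mem_toFinset, Polynomial.mem_roots hp,
    Polynomial.IsRoot.def]
  rw [← h0]
  simp [circleMap, add_comm]

theorem norm_eval_factor_le {a : ℝ} (ha : 0 < a) {p q : ℂ[X]} (hp : p.Monic) (hq : q.Monic)
    (hqp : q ∣ p) (u : ℝ) :
    ‖q.eval (u : ℂ)‖ ≤
      (2 / a * exp (posLogPotential a u)) ^ p.natDegree * supNorm (realSegment a) p := by
  set L : ℂ[X] := Polynomial.X + Polynomial.C (u : ℂ) with hL
  obtain ⟨s, rfl⟩ := hqp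
  have hs : s.Monic := hq.of_mul_monic_left hp
  have h1 : ‖q.eval (u : ℂ)‖ ≤ ((q * s).comp L).mahlerMeasure := by
    -- `q(u)` is the constant coefficient of `q(X + u)`, and the binomial factor in the coefficient
    -- bound is then 1.
    have h0 := Polynomial.norm_coeff_le_choose_mul_mahlerMeasure 0 (q.comp L)
    rw [Polynomial.coeff_zero_eq_eval_zero, Polynomial.eval_comp] at h0
    simp only [hL, Polynomial.eval_add, Polynomial.eval_X, Polynomial.eval_C, zero_add,
      Nat.choose_zero_right, Nat.cast_one, one_mul] at h0
    refine h0.trans ?_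
    rw [Polynomial.mul_comp, Polynomial.mahlerMeasure_mul]
    refine le_mul_of_one_le_right (Polynomial.mahlerMeasure_nonneg _) ?_
    refine Polynomial.one_le_mahlerMeasure_of_one_le_norm_leadingCoeff ?_
    rw [(hs.comp_X_add_C (u : ℂ)).leadingCoeff, norm_one]
  have hM : ((q * s).comp L).mahlerMeasure ≠ 0 := by
    rw [Ne, Polynomial.mahlerMeasure_eq_zero_iff]
    exact (hp.comp_X_add_C (u : ℂ)).ne_zero
  have h2 := logMahlerMeasure_comp_X_add_C_le ha hp.ne_zero u
  rw [Polynomial.logMahlerMeasure_eq_log_MahlerMeasure] at h2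
  have hMpos := (Polynomial.mahlerMeasure_nonneg ((q * s).comp L)).lt_of_ne hM.symm
  refine h1.trans (((log_le_iff_le_exp hMpos).1 h2).trans (le_of_eq ?_))
  have e : (2 / a * exp (posLogPotential a u)) = exp (posLogPotential a u - log (a / 2)) := by
    rw [exp_sub, exp_log (by positivity)]
    field_simp
  rw [exp_add, exp_log (supNorm_pos ha hp.ne_zero), e, ← exp_nat_mul, mul_comm]

theorem factorInequality_of_posLogPotential_le {a m : ℝ} (ha : 0 < a)
    (hm : ∀ u ∈ Icc (-a) a, posLogPotential a u ≤ m) :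
    FactorInequality (realSegment a) (2 / a * exp m) := by
  intro p q hp hq hqp
  obtain ⟨u, hu, hqu⟩ := exists_supNorm_eq ha q
  rw [hqu]
  refine (norm_eval_factor_le ha hp hq hqp u).trans ?_
  refine mul_le_mul_of_nonneg_right ?_ (supNorm_nonneg _ _)
  refine pow_le_pow_left₀ (by positivity) ?_ _
  exact mul_le_mul_of_nonneg_left (exp_le_exp.2 (hm u hu)) (by positivity)

end UpperBound

/-! ### The truncated potential is largest at the endpoints. -/

section EndpointMaximum

open Real

theorem posLogPotential_eq_of_le_one {a u : ℝ} (h : ∀ θ, |u - a * cos θ| ≤ 1) :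
    posLogPotential a u = 0 := by
  have : ∀ θ, log⁺ (u - a * cos θ) = 0 := fun θ => (posLog_eq_zero_iff _).2 (h θ)
  simp [posLogPotential, this]

/-- No point of the segment lies more than 1 to the right of `u`, so only points to the left
contribute, and their distance grows with `u`. -/
theorem posLogPotential_mono_of_sub_one_le {a u v : ℝ} (ha : 0 < a) (hu : a - 1 ≤ u)
    (huv : u ≤ v) : posLogPotential a u ≤ posLogPotential a v := by
  unfold posLogPotential
  refine mul_le_mul_of_nonneg_left ?_ (by positivity)
  refine intervalIntegral.integral_mono_on pi_pos.le
    ((continuous_posLog_sub_mul_cos a u).intervalIntegrable _ _)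
    ((continuous_posLog_sub_mul_cos a v).intervalIntegrable _ _) fun θ _ => ?_
  rcases le_total 0 (u - a * cos θ) with h | h
  · exact posLog_le_posLog h (by linarith)
  · have : log⁺ (u - a * cos θ) = 0 := by
      rw [posLog_eq_zero_iff, abs_le]
      constructor <;> nlinarith [cos_le_one θ]
    rw [this]
    exact posLog_nonneg

/-- The square root of a positive concave function is concave, and `x ↦ x⁻¹` is convex and
decreasing on the positive reals. -/
theorem convexOn_inv_sqrt_sq_sub_sq (a : ℝ) :
    ConvexOn ℝ (Ioo (-a) a) fun t => (√(a ^ 2 - t ^ 2))⁻¹ := by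
  have hpos : ∀ t ∈ Ioo (-a) a, 0 < a ^ 2 - t ^ 2 := fun t ht => by nlinarith [ht.1, ht.2]
  have h1 : ConcaveOn ℝ (Ioo (-a) a) fun t => a ^ 2 - t ^ 2 := by
    refine (concaveOn_const _ (convex_Ioo _ _)).sub ?_
    exact (even_two.convexOn_pow (𝕜 := ℝ)).subset (subset_univ _) (convex_Ioo _ _)
  refine ⟨convex_Ioo _ _, fun x hx y hy r s hr hs hrs => ?_⟩
  have hz := convex_Ioo (-a) a hx hy hr hs hrs
  have h2 : r • √(a ^ 2 - x ^ 2) + s • √(a ^ 2 - y ^ 2) ≤ √(a ^ 2 - (r • x + s • y) ^ 2) :=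
    (strictConcaveOn_sqrt.concaveOn.2 (hpos x hx).le (hpos y hy).le hr hs hrs).trans
      (sqrt_le_sqrt (h1.2 hx hy hr hs hrs))
  have px := sqrt_pos.2 (hpos x hx)
  have py := sqrt_pos.2 (hpos y hy)
  have hconv := (convexOn_zpow (𝕜 := ℝ) (-1)).2 (mem_Ioi.2 px) (mem_Ioi.2 py) hr hs hrs
  simp only [zpow_neg_one] at hconv
  refine le_trans ?_ hconv
  refine inv_anti₀ ?_ h2
  exact (convex_Ioi (0 : ℝ)) (mem_Ioi.2 px) (mem_Ioi.2 py) hr hs hrs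

/-- The sum of the values of an even convex function at `u ± s` is monotone in `u ≥ 0`. -/
theorem ConvexOn.add_shift_le_of_even {f : ℝ → ℝ} {a : ℝ} (hf : ConvexOn ℝ (Ioo (-a) a) f)
    (heven : ∀ t, f (-t) = f t) {u v s : ℝ} (hu : 0 ≤ u) (huv : u ≤ v) (h1 : v + s < a)
    (h2 : v - s < a) : f (u + s) + f (u - s) ≤ f (v + s) + f (v - s) := by
  rcases huv.eq_or_lt with rfl | hlt
  · exact le_rfl
  have hv : 0 < v := hu.trans_lt hlt
  -- Weights with `r + r' = 1` and `(r - r') v = u`: they write `u + s` as a mean of `v + s` and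
  -- `-(v - s)`, and `u - s` as a mean of `v - s` and `-(v + s)`. Evenness removes the signs.
  set r := (u + v) / (2 * v) with hr
  set r' := (v - u) / (2 * v) with hr'
  have hr0 : 0 ≤ r := by positivity
  have hr0' : 0 ≤ r' := div_nonneg (by linarith) (by positivity)
  have hsum : r + r' = 1 := by rw [hr, hr']; field_simp; ring
  have hdiff : r * v - r' * v = u := by rw [hr, hr']; field_simp; ring
  have ma : v + s ∈ Ioo (-a) a := ⟨by linarith, h1⟩
  have mb : v - s ∈ Ioo (-a) a := ⟨by linarith, h2⟩
  have ma' : -(v + s) ∈ Ioo (-a) a := ⟨by linarith, by linarith⟩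
  have mb' : -(v - s) ∈ Ioo (-a) a := ⟨by linarith, by linarith⟩
  have c1 := hf.2 ma mb' hr0 hr0' hsum
  have c2 := hf.2 mb ma' hr0 hr0' hsum
  simp only [smul_eq_mul, heven] at c1 c2
  have e1 : r * (v + s) + r' * -(v - s) = u + s := by linear_combination hdiff + s * hsum
  have e2 : r * (v - s) + r' * -(v + s) = u - s := by linear_combination hdiff - s * hsum
  rw [e1] at c1
  rw [e2] at c2
  linear_combination c1 + c2 + (f (v + s) + f (v - s)) * hsum

/-- Frostman's constancy of the equilibrium potential: a point of the segment has `‖w‖ = 1`, so both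
`log⁺` terms vanish. -/
theorem circleAverage_log_abs_sub_mul_cos {a u : ℝ} (ha : 0 < a) (hu : u ∈ Icc (-a) a) :
    IntervalIntegrable (fun θ => log (u - a * cos θ)) volume 0 π ∧
      π⁻¹ * ∫ θ in (0 : ℝ)..π, log (u - a * cos θ) = log (a / 2) := by
  have hua : a * cos (arccos (u / a)) = u := by
    rw [cos_arccos (by rw [le_div_iff₀ ha]; linarith [hu.1])
      (by rw [div_le_iff₀ ha]; linarith [hu.2])]
    field_simp
  set w := circleMap 0 1 (arccos (u / a)) with hw
  have hw1 : ‖w‖ = 1 := by simp [hw]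
  have hw0 : w ≠ 0 := by rintro h; simp [h] at hw1
  have huw : (a / 2 * (w + w⁻¹) : ℂ) = (u : ℂ) := by rw [hw, joukowski_circleMap, hua]
  have h := circleAverage_log_norm_joukowski_sub ha hw0
  have hi := circleIntegrable_log_norm_sub_joukowski a u
  rw [CircleIntegrable] at hi
  have hn : ∀ θ, log ‖(u : ℂ) - a / 2 * (circleMap 0 1 θ + (circleMap 0 1 θ)⁻¹)‖ =
      log (u - a * cos θ) := fun θ => by
    rw [joukowski_circleMap, ← Complex.ofReal_sub, Complex.norm_real, Real.norm_eq_abs, log_abs]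
  rw [huw, norm_inv, hw1, inv_one, posLog_one, add_zero, add_zero, circleAverage_def,
    smul_eq_mul] at h
  simp only [hn] at h hi
  have hi' := intervalIntegrable_comp_cos_of_two_pi (f := fun x => log (u - a * x)) hi
  refine ⟨hi', ?_⟩
  rw [integral_comp_cos_zero_two_pi (f := fun x => log (u - a * x)) hi'] at h
  rw [← h]
  field_simp

theorem posLogPotential_eq_log_add {a u : ℝ} (ha : 0 < a) (hu : u ∈ Icc (-a) a) :
    Integrable (fun t => log⁺ (u - t)⁻¹ / (π * √(a ^ 2 - t ^ 2))) ∧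
      posLogPotential a u =
        log (a / 2) + ∫ t, log⁺ (u - t)⁻¹ / (π * √(a ^ 2 - t ^ 2)) := by
  obtain ⟨hi, hl⟩ := circleAverage_log_abs_sub_mul_cos ha hu
  have hc := (continuous_posLog_sub_mul_cos a u).intervalIntegrable (μ := volume) 0 π
  have he : ∀ θ, log⁺ (u - a * cos θ)⁻¹ = log⁺ (u - a * cos θ) - log (u - a * cos θ) := fun θ => by
    linarith [posLog_sub_posLog_inv (x := u - a * cos θ)]
  have hii : IntervalIntegrable (fun θ => log⁺ (u - a * cos θ)⁻¹) volume 0 π := by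
    simp only [he]
    exact hc.sub hi
  have hsupp : (Function.support fun t => log⁺ (u - t)⁻¹ / (π * √(a ^ 2 - t ^ 2))) ⊆
      Icc (-a) a := by
    intro t ht
    by_contra h
    refine ht ?_
    -- Off the segment the root and hence the quotient are 0 by convention, so the density extends
    -- to the whole line and can be translated and reflected freely.
    have : √(a ^ 2 - t ^ 2) = 0 := sqrt_eq_zero_of_nonpos (by
      by_contra! h1
      exact h (abs_le.1 (abs_le_of_sq_le_sq (by linarith) ha.le)))
    simp [this]
  constructor
  · rw [← integrableOn_iff_integrable_of_support_subset hsupp]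
    refine (integrableOn_arcsine_iff ha fun t => log⁺ (u - t)⁻¹).2 ?_
    exact ((intervalIntegrable_iff_integrableOn_Ioo_of_le pi_pos.le).1 hii)
  · rw [← setIntegral_eq_integral_of_forall_compl_eq_zero (s := Icc (-a) a)
      (fun t ht => Function.notMem_support.1 fun h => ht (hsupp h)),
      setIntegral_arcsine ha fun t => log⁺ (u - t)⁻¹]
    simp only [he]
    rw [intervalIntegral.integral_sub hc hi, mul_sub, hl, posLogPotential]
    ring

/-- Averaging the substitutions `t = u + s` and `t = u - s` moves the dependence on `u` into the
symmetrized density. The weight `log⁺ s⁻¹` lives on `|s| < 1`, where `v ± s` stays below `a` and the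
convexity inequality applies. -/
theorem posLogPotential_mono_of_le_sub_one {a u v : ℝ} (hu : 0 ≤ u) (huv : u ≤ v)
    (hv : v ≤ a - 1) : posLogPotential a u ≤ posLogPotential a v := by
  have ha : 0 < a := by linarith
  have key : ∀ u ∈ Icc (-a) a,
      Integrable (fun s => log⁺ s⁻¹ * ((√(a ^ 2 - (u + s) ^ 2))⁻¹ + (√(a ^ 2 - (u - s) ^ 2))⁻¹)) ∧
      posLogPotential a u = log (a / 2) + (2 * π)⁻¹ * ∫ s, log⁺ s⁻¹ *
        ((√(a ^ 2 - (u + s) ^ 2))⁻¹ + (√(a ^ 2 - (u - s) ^ 2))⁻¹) := by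
    intro u hu
    obtain ⟨hi, he⟩ := posLogPotential_eq_log_add ha hu
    set g : ℝ → ℝ := fun t => log⁺ (u - t)⁻¹ / (π * √(a ^ 2 - t ^ 2)) with hg
    have e1 := integral_sub_left_eq_self g volume u
    have e2 := integral_add_left_eq_self (μ := volume) g u
    have i1 : Integrable fun s => g (u - s) := hi.comp_sub_left u
    have i2 : Integrable fun s => g (u + s) := hi.comp_add_left u
    have hsum : (fun s => log⁺ s⁻¹ *
        ((√(a ^ 2 - (u + s) ^ 2))⁻¹ + (√(a ^ 2 - (u - s) ^ 2))⁻¹)) =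
        fun s => π * (g (u + s) + g (u - s)) := by
      ext s
      have h1 : log⁺ (u - (u + s))⁻¹ = log⁺ s⁻¹ := by
        rw [← posLog_neg, ← inv_neg]; ring_nf
      have h2 : log⁺ (u - (u - s))⁻¹ = log⁺ s⁻¹ := by ring_nf
      simp only [hg, h1, h2, div_eq_mul_inv, mul_inv]
      field_simp
    rw [hsum]
    refine ⟨(i2.add i1).const_mul π, ?_⟩
    rw [integral_const_mul, integral_add i2 i1, e1, e2, he]
    field_simp
    ring
  obtain ⟨iu, eu⟩ := key u ⟨by linarith, by linarith⟩
  obtain ⟨iv, ev⟩ := key v ⟨by linarith, by linarith⟩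
  rw [eu, ev]
  refine add_le_add_right (mul_le_mul_of_nonneg_left (integral_mono iu iv fun s => ?_)
    (by positivity)) _
  rcases lt_or_ge |s| 1 with hs | hs
  · rw [abs_lt] at hs
    refine mul_le_mul_of_nonneg_left ?_ posLog_nonneg
    exact (convexOn_inv_sqrt_sq_sub_sq a).add_shift_le_of_even (fun t => by rw [neg_sq]) hu huv
      (by linarith) (by linarith)
  · have : log⁺ s⁻¹ = 0 := by
      rw [posLog_eq_zero_iff, abs_inv]
      exact inv_le_one_of_one_le₀ hs
    simp [this]

theorem posLogPotential_le_right {a u : ℝ} (ha : 0 < a) (hu : u ∈ Icc (-a) a) :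
    posLogPotential a u ≤ posLogPotential a a := by
  have main : ∀ v, 0 ≤ v → v ≤ a → posLogPotential a v ≤ posLogPotential a a := by
    intro v h0 hv
    rcases le_total v (a - 1) with h | h
    · exact (posLogPotential_mono_of_le_sub_one h0 h le_rfl).trans
        (posLogPotential_mono_of_sub_one_le ha le_rfl (by linarith))
    · exact posLogPotential_mono_of_sub_one_le ha h hv
  rcases le_total 0 u with h | h
  · exact main u h hu.2
  · rw [← posLogPotential_neg]
    exact main (-u) (by linarith) (by linarith [hu.1])

end EndpointMaximum

/-! ### Lower bound from factors of Chebyshev polynomials. -/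

section LowerBound

open Real

/-- The zeros of the Chebyshev polynomial of degree `n`, as angles. -/
noncomputable def chebyshevAngle (n k : ℕ) : ℝ := (2 * k + 1) * π / (2 * n)

theorem prod_sub_cos_chebyshevAngle {n : ℕ} (x : ℝ) :
    (2 : ℝ) ^ (n - 1) * ∏ k ∈ Finset.range n, (x - cos (chebyshevAngle n k)) =
      (Polynomial.Chebyshev.T ℝ n).eval x := by
  have hinj := (Finset.range n).nodup_map_iff_injOn.mp
    (Polynomial.Chebyshev.roots_T_real_nodup n)
  have hroots := Polynomial.Chebyshev.roots_T_real n
  have hcard : (Polynomial.Chebyshev.T ℝ n).roots.card =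
      (Polynomial.Chebyshev.T ℝ n).natDegree := by
    rw [hroots, Finset.card_val, Finset.card_image_of_injOn hinj]
    simp
  have h := Polynomial.C_leadingCoeff_mul_prod_multiset_X_sub_C hcard
  rw [← h, hroots]
  rw [Polynomial.Chebyshev.leadingCoeff_T]
  simp only [Polynomial.eval_mul, Polynomial.eval_C]
  rw [← Finset.prod_eq_multiset_prod, Finset.prod_image hinj, Polynomial.eval_prod]
  simp [chebyshevAngle]

/-- The monic polynomial with the zeros `a cos θ_k`, `k ∈ s`, where the `a cos θ_k` are the
Chebyshev nodes of `[-a, a]`. -/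
noncomputable def chebyshevFactor (a : ℝ) (n : ℕ) (s : Finset ℕ) : ℂ[X] :=
  ∏ k ∈ s, (Polynomial.X - Polynomial.C ((a * cos (chebyshevAngle n k) : ℝ) : ℂ))

theorem monic_chebyshevFactor (a : ℝ) (n : ℕ) (s : Finset ℕ) : (chebyshevFactor a n s).Monic :=
  Polynomial.monic_prod_of_monic _ _ fun _ _ => Polynomial.monic_X_sub_C _

theorem natDegree_chebyshevFactor (a : ℝ) (n : ℕ) (s : Finset ℕ) :
    (chebyshevFactor a n s).natDegree = s.card := by
  rw [chebyshevFactor, Polynomial.natDegree_finsetProd_X_sub_C_eq_card]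

theorem norm_eval_chebyshevFactor (a : ℝ) (n : ℕ) (s : Finset ℕ) (x : ℝ) :
    ‖(chebyshevFactor a n s).eval (x : ℂ)‖ =
      ∏ k ∈ s, |x - a * cos (chebyshevAngle n k)| := by
  rw [chebyshevFactor, Polynomial.eval_prod, norm_prod]
  refine Finset.prod_congr rfl fun k _ => ?_
  rw [Polynomial.eval_sub, Polynomial.eval_X, Polynomial.eval_C, ← Complex.ofReal_sub,
    Complex.norm_real, Real.norm_eq_abs]

theorem supNorm_chebyshevFactor_le {a : ℝ} (ha : 0 < a) {n : ℕ} (hn : n ≠ 0) :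
    supNorm (realSegment a) (chebyshevFactor a n (Finset.range n)) ≤ 2 * (a / 2) ^ n := by
  obtain ⟨x, hx, he⟩ := exists_supNorm_eq ha (chebyshevFactor a n (Finset.range n))
  rw [he, norm_eval_chebyshevFactor]
  have h1 : ∀ k, |x - a * cos (chebyshevAngle n k)| =
      a * |x / a - cos (chebyshevAngle n k)| := fun k => by
    nth_rw 2 [← abs_of_pos ha]
    rw [← abs_mul, mul_sub, mul_div_cancel₀ _ ha.ne']
  have hxa : |x / a| ≤ 1 := by
    rw [abs_div, abs_of_pos ha, div_le_one ha]
    exact abs_le.2 hx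
  have hT := Polynomial.Chebyshev.abs_eval_T_real_le_one n hxa
  rw [← prod_sub_cos_chebyshevAngle, abs_mul, abs_of_pos (by positivity), Finset.abs_prod] at hT
  simp only [h1]
  rw [Finset.prod_mul_distrib, Finset.prod_const, Finset.card_range, div_pow]
  obtain ⟨m, rfl⟩ := Nat.exists_eq_succ_of_ne_zero hn
  simp only [Nat.succ_eq_add_one, Nat.add_sub_cancel] at hT ⊢
  -- Scaling contributes `a ^ n`, and the leading coefficient of `T_n` contributes `1 / 2 ^ (n -
  -- 1)`, with `n = m + 1`.
  have : 2 * (a ^ (m + 1) / 2 ^ (m + 1)) = a ^ (m + 1) * (1 / 2 ^ m) := by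
    field_simp; ring
  rw [this]
  refine mul_le_mul_of_nonneg_left ?_ (by positivity)
  rw [le_div_iff₀ (by positivity), mul_comm]
  exact hT

theorem exists_factor_norm_eval_eq_exp {a : ℝ} (n : ℕ) (u : ℝ) :
    ∃ q : ℂ[X], q.Monic ∧ q ∣ chebyshevFactor a n (Finset.range n) ∧
      ‖q.eval (u : ℂ)‖ =
        exp (∑ k ∈ Finset.range n, log⁺ (u - a * cos (chebyshevAngle n k))) := by
  classical
  -- Dropping exactly the zeros closer than 1 makes `|q(u)|` as large as possible.
  set s := (Finset.range n).filter fun k => 1 ≤ |u - a * cos (chebyshevAngle n k)| with hs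
  refine ⟨chebyshevFactor a n s, monic_chebyshevFactor _ _ _,
    Finset.prod_dvd_prod_of_subset _ _ _ (Finset.filter_subset _ _), ?_⟩
  rw [norm_eval_chebyshevFactor, hs, Finset.prod_filter, exp_sum]
  refine Finset.prod_congr rfl fun k _ => ?_
  split_ifs with h
  · rw [posLog_eq_log h, ← log_abs, exp_log (by linarith)]
  · rw [(posLog_eq_zero_iff _).2 (not_le.1 h).le, exp_zero]

/-- Midpoint Riemann sums of a continuous function converge to its integral. -/
theorem tendsto_midpoint_sum {f : ℝ → ℝ} (hf : Continuous f) :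
    Filter.Tendsto (fun n : ℕ => (∑ k ∈ Finset.range n, f (chebyshevAngle n k)) / n)
      Filter.atTop (nhds (π⁻¹ * ∫ θ in (0 : ℝ)..π, f θ)) := by
  have huc := isCompact_Icc.uniformContinuousOn_of_continuous (hf.continuousOn (s := Icc 0 π))
  rw [Metric.uniformContinuousOn_iff] at huc
  rw [Metric.tendsto_atTop]
  intro ε hε
  obtain ⟨δ, hδ, hfδ⟩ := huc (ε / 2) (by positivity)
  obtain ⟨N, hN⟩ := exists_nat_gt (π / δ)
  refine ⟨N + 1, fun n hn => ?_⟩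
  have hn0 : 0 < (n : ℝ) := by exact_mod_cast (by omega : 0 < n)
  have hnδ : π / n < δ := by
    rw [div_lt_iff₀ hδ] at hN
    rw [div_lt_iff₀ hn0]
    have : (N : ℝ) ≤ n := by exact_mod_cast (by omega : N ≤ n)
    nlinarith
  have hsplit : ∫ θ in (0 : ℝ)..π, f θ =
      ∑ k ∈ Finset.range n, ∫ θ in (k * (π / n))..((k + 1 : ℕ) * (π / n)), f θ := by
    rw [intervalIntegral.sum_integral_adjacent_intervals (a := fun k : ℕ => (k : ℝ) * (π / n))
      fun k _ => hf.intervalIntegrable _ _]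
    congr 1
    · simp
    · field_simp
  have hterm : ∀ k ∈ Finset.range n,
      |f (chebyshevAngle n k) * (π / n) -
        ∫ θ in (k * (π / n))..((k + 1 : ℕ) * (π / n)), f θ| ≤ ε / 2 * (π / n) := by
    intro k hk
    have hkn : ((k + 1 : ℕ) : ℝ) ≤ n := by exact_mod_cast Finset.mem_range.1 hk
    have hlen : ((k + 1 : ℕ) : ℝ) * (π / n) - k * (π / n) = π / n := by push_cast; ring
    have hc : f (chebyshevAngle n k) * (π / n) =
        ∫ θ in (k * (π / n))..((k + 1 : ℕ) * (π / n)), f (chebyshevAngle n k) := by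
      rw [intervalIntegral.integral_const, hlen, smul_eq_mul, mul_comm]
    rw [hc, ← intervalIntegral.integral_sub intervalIntegrable_const (hf.intervalIntegrable _ _),
      ← Real.norm_eq_abs]
    refine (intervalIntegral.norm_integral_le_of_norm_le_const (C := ε / 2) fun θ hθ => ?_).trans
      (le_of_eq ?_)
    · rw [uIoc_of_le (by nlinarith [hlen, (by positivity : 0 < π / n)])] at hθ
      have hpn : 0 < π / n := by positivity
      -- The Chebyshev angles are the midpoints of the `n` equal cells of `[0, π]`.
      have e : chebyshevAngle n k = k * (π / n) + (π / n) / 2 := by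
        rw [chebyshevAngle]; field_simp
      have htop : ((k + 1 : ℕ) : ℝ) * (π / n) ≤ π := by
        calc ((k + 1 : ℕ) : ℝ) * (π / n) ≤ n * (π / n) := by gcongr
          _ = π := by field_simp
      have h0 : (0 : ℝ) ≤ k * (π / n) := by positivity
      have := hfδ (chebyshevAngle n k) ⟨by rw [e]; linarith, by rw [e]; linarith⟩ θ
        ⟨by linarith [hθ.1], by linarith [hθ.2]⟩ ?_
      · rw [Real.dist_eq] at this
        exact this.le
      · rw [Real.dist_eq, e, abs_lt]
        constructor <;> linarith [hθ.1, hθ.2]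
    · rw [hlen, abs_of_pos (by positivity)]
  have hsum : |(∑ k ∈ Finset.range n, f (chebyshevAngle n k)) * (π / n) -
      ∫ θ in (0 : ℝ)..π, f θ| ≤ ε / 2 * π := by
    rw [hsplit, Finset.sum_mul, ← Finset.sum_sub_distrib]
    refine (Finset.abs_sum_le_sum_abs _ _).trans ((Finset.sum_le_sum hterm).trans (le_of_eq ?_))
    rw [Finset.sum_const, Finset.card_range, nsmul_eq_mul]
    field_simp
  have hfin : (∑ k ∈ Finset.range n, f (chebyshevAngle n k)) / n - π⁻¹ * ∫ θ in (0 : ℝ)..π, f θ =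
      π⁻¹ * ((∑ k ∈ Finset.range n, f (chebyshevAngle n k)) * (π / n) -
        ∫ θ in (0 : ℝ)..π, f θ) := by
    field_simp
  rw [Real.dist_eq, hfin, abs_mul, abs_of_pos (by positivity)]
  calc π⁻¹ * _ ≤ π⁻¹ * (ε / 2 * π) := by gcongr
    _ = ε / 2 := by field_simp
    _ < ε := by linarith

theorem le_of_factorInequality {a u C : ℝ} (ha : 0 < a) (hu : u ∈ Icc (-a) a) (hC : 0 < C)
    (h : FactorInequality (realSegment a) C) : 2 / a * exp (posLogPotential a u) ≤ C := by
  have hlim := tendsto_midpoint_sum (continuous_posLog_sub_mul_cos a u)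
  -- The `n`-th root of `C ^ n * (2 * (a / 2) ^ n)`, in logarithmic form; the factor 2 disappears in
  -- the limit.
  have hlim2 : Filter.Tendsto (fun n : ℕ => log 2 / n + (log (a / 2) + log C))
      Filter.atTop (nhds (0 + (log (a / 2) + log C))) :=
    (tendsto_const_div_atTop_nhds_zero_nat _).add tendsto_const_nhds
  have hle := le_of_tendsto_of_tendsto hlim hlim2 (by
    filter_upwards [Filter.eventually_ge_atTop 1] with n hn
    have hn0 : n ≠ 0 := by omega
    have hn' : (0 : ℝ) < n := by exact_mod_cast hn
    obtain ⟨q, hq, hqp, hqu⟩ := exists_factor_norm_eval_eq_exp (a := a) n u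
    have h1 := h _ q (monic_chebyshevFactor a n (Finset.range n)) hq hqp
    rw [natDegree_chebyshevFactor, Finset.card_range] at h1
    have h2 := (norm_eval_le_supNorm q (mem_image_of_mem _ hu)).trans (h1.trans
      (mul_le_mul_of_nonneg_left (supNorm_chebyshevFactor_le ha hn0) (by positivity)))
    rw [hqu, ← le_log_iff_exp_le (by positivity), log_mul (by positivity) (by positivity),
      log_mul (by positivity) (by positivity), log_pow, log_pow] at h2
    rw [div_le_iff₀ hn']
    have e : (log 2 / n + (log (a / 2) + log C)) * n = n * log C + (log 2 + n * log (a / 2)) := by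
      field_simp; ring
    rw [e]
    exact h2)
  rw [zero_add] at hle
  have h3 : exp (posLogPotential a u) ≤ a / 2 * C := by
    rw [← le_log_iff_exp_le (by positivity), log_mul (by positivity) (by positivity)]
    exact hle
  calc 2 / a * exp (posLogPotential a u) ≤ 2 / a * (a / 2 * C) := by gcongr
    _ = C := by field_simp

end LowerBound

/-! ### Numerical value for `a = 2`. -/

section NumericalValue

open Real

/-- Drives the Taylor bounds that follow: each error term has the preceding one as its derivative,
starting from `sin_ge_sub_cube`. -/
theorem nonneg_of_hasDerivAt_nonneg {f f' : ℝ → ℝ} (hf : ∀ x, HasDerivAt f (f' x) x)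
    (h0 : f 0 = 0) (h' : ∀ x, 0 ≤ x → 0 ≤ f' x) {x : ℝ} (hx : 0 ≤ x) : 0 ≤ f x := by
  have hm : MonotoneOn f (Ici 0) := by
    refine monotoneOn_of_deriv_nonneg (convex_Ici 0)
      (fun y _ => (hf y).continuousAt.continuousWithinAt)
      (fun y _ => (hf y).differentiableAt.differentiableWithinAt) fun y hy => ?_
    rw [(hf y).deriv]
    rw [interior_Ici] at hy
    exact h' y (mem_Ioi.1 hy).le
  have := hm self_mem_Ici hx hx
  rwa [h0] at this

theorem cos_le_quartic {x : ℝ} (hx : 0 ≤ x) : cos x ≤ 1 - x ^ 2 / 2 + x ^ 4 / 24 := by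
  have h := nonneg_of_hasDerivAt_nonneg (f := fun x => 1 - x ^ 2 / 2 + x ^ 4 / 24 - cos x)
    (f' := fun x => sin x - (x - x ^ 3 / 6)) (fun x => ?_) (by simp)
    (fun x hx => sub_nonneg.2 (sin_ge_sub_cube hx)) hx
  · simp only [sub_nonneg] at h; exact h
  · have := ((((hasDerivAt_pow 2 x).div_const 2).const_sub 1).add
      ((hasDerivAt_pow 4 x).div_const 24)).sub (hasDerivAt_cos x)
    refine this.congr_deriv ?_
    push_cast; ring

theorem sin_le_quintic {x : ℝ} (hx : 0 ≤ x) : sin x ≤ x - x ^ 3 / 6 + x ^ 5 / 120 := by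
  have h := nonneg_of_hasDerivAt_nonneg (f := fun x => x - x ^ 3 / 6 + x ^ 5 / 120 - sin x)
    (f' := fun x => 1 - x ^ 2 / 2 + x ^ 4 / 24 - cos x) (fun x => ?_) (by simp)
    (fun x hx => sub_nonneg.2 (cos_le_quartic hx)) hx
  · simp only [sub_nonneg] at h; exact h
  · have := (((hasDerivAt_id' x).sub ((hasDerivAt_pow 3 x).div_const 6)).add
      ((hasDerivAt_pow 5 x).div_const 120)).sub (hasDerivAt_sin x)
    refine this.congr_deriv ?_
    push_cast; ring

theorem sextic_le_cos {x : ℝ} (hx : 0 ≤ x) :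
    1 - x ^ 2 / 2 + x ^ 4 / 24 - x ^ 6 / 720 ≤ cos x := by
  have h := nonneg_of_hasDerivAt_nonneg
    (f := fun x => cos x - (1 - x ^ 2 / 2 + x ^ 4 / 24 - x ^ 6 / 720))
    (f' := fun x => x - x ^ 3 / 6 + x ^ 5 / 120 - sin x) (fun x => ?_) (by simp)
    (fun x hx => sub_nonneg.2 (sin_le_quintic hx)) hx
  · simp only [sub_nonneg] at h; exact h
  · have := (hasDerivAt_cos x).sub (((((hasDerivAt_pow 2 x).div_const 2).const_sub 1).add
      ((hasDerivAt_pow 4 x).div_const 24)).sub ((hasDerivAt_pow 6 x).div_const 720))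
    refine this.congr_deriv ?_
    push_cast; ring

theorem septic_le_sin {x : ℝ} (hx : 0 ≤ x) :
    x - x ^ 3 / 6 + x ^ 5 / 120 - x ^ 7 / 5040 ≤ sin x := by
  have h := nonneg_of_hasDerivAt_nonneg
    (f := fun x => sin x - (x - x ^ 3 / 6 + x ^ 5 / 120 - x ^ 7 / 5040))
    (f' := fun x => cos x - (1 - x ^ 2 / 2 + x ^ 4 / 24 - x ^ 6 / 720)) (fun x => ?_) (by simp)
    (fun x hx => sub_nonneg.2 (sextic_le_cos hx)) hx
  · simp only [sub_nonneg] at h; exact h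
  · have := (hasDerivAt_sin x).sub ((((hasDerivAt_id' x).sub
      ((hasDerivAt_pow 3 x).div_const 6)).add ((hasDerivAt_pow 5 x).div_const 120)).sub
      ((hasDerivAt_pow 7 x).div_const 5040))
    refine this.congr_deriv ?_
    push_cast; ring

theorem sinc_pos_of_mem {x : ℝ} (h0 : 0 ≤ x) (h1 : x < π) : 0 < sinc x := by
  rcases h0.eq_or_lt with rfl | h
  · simp
  · rw [sinc_of_ne_zero h.ne']
    exact div_pos (sin_pos_of_pos_of_lt_pi h h1) h

theorem sin_eq_mul_sinc (x : ℝ) : sin x = x * sinc x := by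
  rcases eq_or_ne x 0 with rfl | h
  · simp
  · rw [sinc_of_ne_zero h]; field_simp

/-- `cos x / sinc x` is `x cot x` with the singularity at 0 removed; the bound truncates its Taylor
series. -/
theorem cos_div_sinc_le {x : ℝ} (h0 : 0 < x) (h1 : x ≤ 1) :
    cos x / sinc x ≤ 1 - x ^ 2 / 3 - x ^ 4 / 45 := by
  rw [div_le_iff₀ (sinc_pos_of_mem h0.le (by linarith [pi_gt_three])), sinc_of_ne_zero h0.ne']
  have hs := septic_le_sin h0.le
  have hc := cos_le_quartic h0.le
  have h2 : x ^ 2 ≤ 1 := pow_le_one₀ h0.le h1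
  have h4 : x ^ 4 ≤ 1 := pow_le_one₀ h0.le h1
  have hs' : 1 - x ^ 2 / 6 + x ^ 4 / 120 - x ^ 6 / 5040 ≤ sin x / x := by
    rw [le_div_iff₀ h0]; linarith
  refine hc.trans (le_trans ?_ (mul_le_mul_of_nonneg_left hs' (by linarith)))
  have h8 : x ^ 8 ≤ x ^ 6 := pow_le_pow_of_le_one h0.le h1 (by norm_num)
  have h6 : 0 ≤ x ^ 6 := by positivity
  have h10 : 0 ≤ x ^ 10 := by positivity
  ring_nf
  linarith

/-- The Taylor coefficient of `x ^ 6` is `-2 / 945`; enlarging it to `-1 / 300` absorbs the tail on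
`(0, 1]`. -/
theorem le_cos_div_sinc {x : ℝ} (h0 : 0 < x) (h1 : x ≤ 1) :
    1 - x ^ 2 / 3 - x ^ 4 / 45 - x ^ 6 / 300 ≤ cos x / sinc x := by
  rw [le_div_iff₀ (sinc_pos_of_mem h0.le (by linarith [pi_gt_three])), sinc_of_ne_zero h0.ne']
  have hs := sin_le_quintic h0.le
  have hc := sextic_le_cos h0.le
  have h2 : x ^ 2 ≤ 1 := pow_le_one₀ h0.le h1
  have h4 : x ^ 4 ≤ 1 := pow_le_one₀ h0.le h1
  have h6 : x ^ 6 ≤ 1 := pow_le_one₀ h0.le h1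
  have hs' : sin x / x ≤ 1 - x ^ 2 / 6 + x ^ 4 / 120 := by
    rw [div_le_iff₀ h0]; linarith
  refine le_trans (mul_le_mul_of_nonneg_left hs' (by linarith)) (le_trans ?_ hc)
  have h8 : x ^ 8 ≤ x ^ 6 := pow_le_pow_of_le_one h0.le h1 (by norm_num)
  have h6 : 0 ≤ x ^ 6 := by positivity
  have h10 : 0 ≤ x ^ 10 := by positivity
  ring_nf
  linarith

theorem hasDerivAt_mul_log_two_mul_sin {x : ℝ} (h0 : 0 < x) (h1 : x < π) :
    HasDerivAt (fun x => x * log (2 * sin x)) (log (2 * sin x) + cos x / sinc x) x := by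
  have hs := sin_pos_of_pos_of_lt_pi h0 h1
  have h := (hasDerivAt_id' x).mul (((hasDerivAt_sin x).const_mul 2).log (by positivity))
  refine h.congr_deriv ?_
  rw [sinc_of_ne_zero h0.ne']
  field_simp

theorem continuousOn_mul_log_two_mul_sin {c : ℝ} (hc : c < π) :
    ContinuousOn (fun x => x * log (2 * sin x)) (Icc 0 c) := by
  have h : EqOn (fun x => x * log (2 * sin x))
      (fun x => (2 * sin x * log (2 * sin x)) / (2 * sinc x)) (Icc 0 c) := by
    intro x hx
    -- Writing `x = sin x / sinc x` exhibits the continuous function `y log y` and settles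
    -- continuity at 0.
    have hs := sinc_pos_of_mem hx.1 (hx.2.trans_lt hc)
    have hx' := sin_eq_mul_sinc x
    dsimp only
    rw [eq_div_iff (by positivity)]
    linear_combination -2 * log (2 * sin x) * hx'
  refine ContinuousOn.congr (ContinuousOn.div ?_ ?_ ?_) h
  · exact (continuous_mul_log.comp (by fun_prop : Continuous fun x => 2 * sin x)).continuousOn
  · exact (continuous_const.mul continuous_sinc).continuousOn
  · intro x hx
    have := sinc_pos_of_mem hx.1 (hx.2.trans_lt hc)
    positivity

theorem intervalIntegrable_log_two_mul_sin (a b : ℝ) :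
    IntervalIntegrable (fun x => log (2 * sin x)) volume a b := by
  have h : MeromorphicOn (fun x => 2 * sin x) (uIcc a b) := by
    intro x _
    fun_prop
  exact h.intervalIntegrable_log

theorem integral_log_two_mul_sin_zero_pi_div_two :
    ∫ x in (0 : ℝ)..π / 2, log (2 * sin x) = 0 := by
  have h : ∫ x in (0 : ℝ)..π / 2, log (2 * sin x) =
      ∫ x in (0 : ℝ)..π / 2, (log 2 + log (sin x)) := by
    refine intervalIntegral.integral_congr_uIoo fun x hx => ?_
    rw [uIoo_of_le (by positivity)] at hx
    have := sin_pos_of_pos_of_lt_pi hx.1 (by linarith [hx.2, pi_pos])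
    exact log_mul two_ne_zero this.ne'
  rw [h, intervalIntegral.integral_add (g := fun x => log (sin x)) intervalIntegrable_const
      intervalIntegrable_log_sin,
    integral_log_sin_zero_pi_div_two, intervalIntegral.integral_const, smul_eq_mul]
  ring

theorem continuousOn_cos_div_sinc {c : ℝ} (hc : c < π) :
    ContinuousOn (fun x => cos x / sinc x) (Icc 0 c) :=
  continuous_cos.continuousOn.div continuous_sinc.continuousOn
    fun _ hx => (sinc_pos_of_mem hx.1 (hx.2.trans_lt hc)).ne'

/-- Integration by parts; the boundary term `x log (2 sin x)` vanishes at 0 and at `π / 6`, where `2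
sin x = 1`. -/
theorem integral_cos_div_sinc_eq :
    ∫ x in (0 : ℝ)..π / 6, cos x / sinc x = -∫ x in (0 : ℝ)..π / 6, log (2 * sin x) := by
  have hc : π / 6 < π := by linarith [pi_pos]
  have hi : IntervalIntegrable (fun x => cos x / sinc x) volume 0 (π / 6) :=
    (continuousOn_cos_div_sinc hc).intervalIntegrable_of_Icc (by positivity)
  have hl := intervalIntegrable_log_two_mul_sin 0 (π / 6)
  have h := intervalIntegral.integral_eq_sub_of_hasDerivAt_of_le (by positivity)
    (continuousOn_mul_log_two_mul_sin hc)
    (fun x hx => hasDerivAt_mul_log_two_mul_sin hx.1 (hx.2.trans hc)) (hl.add hi)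
  rw [intervalIntegral.integral_add hl hi, sin_pi_div_six] at h
  norm_num at h
  linarith

/-- The half-angle formula and a reflection lead to `log (2 sin y)` on `[π / 6, π / 2]`. Its
integral over `[0, π / 2]` is 0, so the range becomes `[0, π / 6]`, where the Taylor bounds are
sharp. -/
theorem integral_log_two_add_two_mul_cos :
    ∫ x in (0 : ℝ)..2 / 3, log (2 + 2 * cos (π * x)) =
      4 / π * ∫ x in (0 : ℝ)..π / 6, cos x / sinc x := by
  have h1 : ∀ x, log (2 + 2 * cos (π * x)) = 2 * log (2 * sin (π / 2 - π / 2 * x)) := fun x => by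
    rw [sin_pi_div_two_sub]
    have : 2 + 2 * cos (π * x) = (2 * cos (π / 2 * x)) ^ 2 := by
      have := cos_sq (π / 2 * x)
      rw [show 2 * (π / 2 * x) = π * x by ring] at this
      rw [mul_pow, this]; ring
    rw [this, log_pow]; norm_num
  simp only [h1]
  rw [intervalIntegral.integral_const_mul,
    intervalIntegral.integral_comp_sub_mul (fun y => log (2 * sin y)) (by positivity),
    show π / 2 - π / 2 * (2 / 3) = π / 6 by ring, mul_zero, sub_zero, integral_cos_div_sinc_eq]
  have h2 := intervalIntegral.integral_add_adjacent_intervals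
    (intervalIntegrable_log_two_mul_sin 0 (π / 6))
    (intervalIntegrable_log_two_mul_sin (π / 6) (π / 2))
  rw [integral_log_two_mul_sin_zero_pi_div_two] at h2
  rw [smul_eq_mul, ← eq_neg_of_add_eq_zero_right h2]
  field_simp
  ring

theorem integral_cos_div_sinc_mem :
    ∫ x in (0 : ℝ)..π / 6, cos x / sinc x ∈
      Icc (π / 6 - (π / 6) ^ 3 / 9 - (π / 6) ^ 5 / 225 - (π / 6) ^ 7 / 2100)
        (π / 6 - (π / 6) ^ 3 / 9 - (π / 6) ^ 5 / 225) := by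
  have hc : π / 6 < π := by linarith [pi_pos]
  have h1 : π / 6 ≤ 1 := by linarith [pi_lt_four]
  have hi : IntervalIntegrable (fun x => cos x / sinc x) volume 0 (π / 6) :=
    (continuousOn_cos_div_sinc hc).intervalIntegrable_of_Icc (by positivity)
  have hU : ∫ x in (0 : ℝ)..π / 6, (1 - x ^ 2 / 3 - x ^ 4 / 45) =
      π / 6 - (π / 6) ^ 3 / 9 - (π / 6) ^ 5 / 225 := by
    refine (intervalIntegral.integral_eq_sub_of_hasDerivAt
      (f := fun x => x - x ^ 3 / 9 - x ^ 5 / 225) (fun x _ => ?_)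
      (Continuous.intervalIntegrable (by fun_prop) _ _)).trans (by simp)
    refine (((hasDerivAt_id' x).sub ((hasDerivAt_pow 3 x).div_const 9)).sub
      ((hasDerivAt_pow 5 x).div_const 225)).congr_deriv ?_
    push_cast; ring
  have hL : ∫ x in (0 : ℝ)..π / 6, (1 - x ^ 2 / 3 - x ^ 4 / 45 - x ^ 6 / 300) =
      π / 6 - (π / 6) ^ 3 / 9 - (π / 6) ^ 5 / 225 - (π / 6) ^ 7 / 2100 := by
    refine (intervalIntegral.integral_eq_sub_of_hasDerivAt
      (f := fun x => x - x ^ 3 / 9 - x ^ 5 / 225 - x ^ 7 / 2100) (fun x _ => ?_)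
      (Continuous.intervalIntegrable (by fun_prop) _ _)).trans (by simp)
    refine ((((hasDerivAt_id' x).sub ((hasDerivAt_pow 3 x).div_const 9)).sub
      ((hasDerivAt_pow 5 x).div_const 225)).sub
      ((hasDerivAt_pow 7 x).div_const 2100)).congr_deriv ?_
    push_cast; ring
  rw [← hL, ← hU]
  constructor
  · exact intervalIntegral.integral_mono_on_of_le_Ioo (by positivity)
      (Continuous.intervalIntegrable (by fun_prop) _ _) hi
      fun x hx => le_cos_div_sinc hx.1 (hx.2.le.trans h1)
  · exact intervalIntegral.integral_mono_on_of_le_Ioo (by positivity) hi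
      (Continuous.intervalIntegrable (by fun_prop) _ _)
      fun x hx => cos_div_sinc_le hx.1 (hx.2.le.trans h1)

/-- Both endpoints lie strictly between `log 1.9081` and `log 1.9082`. -/
theorem integral_log_two_add_two_mul_cos_mem :
    ∫ x in (0 : ℝ)..2 / 3, log (2 + 2 * cos (π * x)) ∈ Icc (0.646112 : ℝ) 0.646145 := by
  obtain ⟨h1, h2⟩ := integral_cos_div_sinc_mem
  rw [integral_log_two_add_two_mul_cos]
  set K := ∫ x in (0 : ℝ)..π / 6, cos x / sinc x
  have p1 := pi_gt_d4
  have p2 := pi_lt_d4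
  have e1 : 4 / π * (π / 6 - (π / 6) ^ 3 / 9 - (π / 6) ^ 5 / 225 - (π / 6) ^ 7 / 2100) =
      2 / 3 - π ^ 2 / 486 - π ^ 4 / 437400 - π ^ 6 / 146966400 := by
    field_simp; ring
  have e2 : 4 / π * (π / 6 - (π / 6) ^ 3 / 9 - (π / 6) ^ 5 / 225) =
      2 / 3 - π ^ 2 / 486 - π ^ 4 / 437400 := by
    field_simp; ring
  have l1 := mul_le_mul_of_nonneg_left h1 (by positivity : 0 ≤ 4 / π)
  have l2 := mul_le_mul_of_nonneg_left h2 (by positivity : 0 ≤ 4 / π)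
  rw [e1] at l1
  rw [e2] at l2
  have b2 : π ^ 2 ≤ 3.1416 ^ 2 := by gcongr
  have b4 : π ^ 4 ≤ 3.1416 ^ 4 := by gcongr
  have b6 : π ^ 6 ≤ 3.1416 ^ 6 := by gcongr
  have c2 : 3.1415 ^ 2 ≤ π ^ 2 := by gcongr
  have c4 : 3.1415 ^ 4 ≤ π ^ 4 := by gcongr
  norm_num at b2 b4 b6 c2 c4
  constructor <;> norm_num <;> linarith

theorem exp_integral_log_two_add_two_mul_cos_bounds :
    1.9081 ≤ exp (∫ x in (0 : ℝ)..2 / 3, log (2 + 2 * cos (π * x))) ∧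
      exp (∫ x in (0 : ℝ)..2 / 3, log (2 + 2 * cos (π * x))) < 1.9082 := by
  obtain ⟨h1, h2⟩ := integral_log_two_add_two_mul_cos_mem
  constructor
  · refine le_trans ?_ (exp_le_exp.2 h1)
    refine le_trans ?_ (sum_le_exp_of_nonneg (by norm_num) 10)
    norm_num [Finset.sum_range_succ, Nat.factorial]
  · refine (exp_le_exp.2 h2).trans_lt ?_
    refine (exp_bound' (by norm_num) (by norm_num) (n := 10) (by norm_num)).trans_lt ?_
    norm_num [Finset.sum_range_succ, Nat.factorial]

end NumericalValue

/-! ### The best constant and its explicit forms. -/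

section BestConstant

open Real

theorem isBestFactorConstant_realSegment {a : ℝ} (ha : 0 < a) :
    IsBestFactorConstant (realSegment a) (2 / a * exp (posLogPotential a a)) :=
  ⟨⟨by positivity, factorInequality_of_posLogPotential_le ha
    fun _ hu => posLogPotential_le_right ha hu⟩,
    fun _ hC => le_of_factorInequality ha ⟨by linarith, le_rfl⟩ hC.1 hC.2⟩

theorem Icc_sdiff_Ioo_neg (a : ℝ) :
    Icc (-a) a \ Ioo (-a - 1) (-a + 1) = Icc (1 - a) a := by
  ext t
  simp only [mem_sdiff, mem_Icc, mem_Ioo, not_and, not_lt]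
  constructor
  · rintro ⟨⟨h1, h2⟩, h3⟩
    exact ⟨by linarith [h3 (by linarith)], h2⟩
  · rintro ⟨h1, h2⟩
    exact ⟨⟨by linarith, h2⟩, fun _ => by linarith⟩

theorem arcsineLogIntegrand_neg (a t : ℝ) :
    arcsineLogIntegrand a (-a) t = log (t + a) / (π * √(a ^ 2 - t ^ 2)) := by
  rw [arcsineLogIntegrand, sub_neg_eq_add, log_abs]

theorem intervalIntegrable_log_add_arcsine {a : ℝ} (ha : 1 / 2 < a) :
    IntervalIntegrable (fun t => log (t + a) / (π * √(a ^ 2 - t ^ 2))) volume (1 - a) a := by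
  have h := integrableOn_arcsineLogIntegrand (by linarith : 0 < a) (-a)
  rw [Icc_sdiff_Ioo_neg, integrableOn_congr_fun
    (fun t _ => arcsineLogIntegrand_neg a t) measurableSet_Icc] at h
  exact (intervalIntegrable_iff_integrableOn_Icc_of_le (by linarith)).2 h

theorem integral_log_add_arcsine {a : ℝ} (ha : 1 / 2 < a) :
    ∫ t in (1 - a)..a, log (t + a) / (π * √(a ^ 2 - t ^ 2)) = posLogPotential a a := by
  rw [← posLogPotential_neg, ← farLogIntegral_eq_posLogPotential (by linarith), farLogIntegral,
    Icc_sdiff_Ioo_neg, setIntegral_congr_fun measurableSet_Icc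
      (fun t _ => arcsineLogIntegrand_neg a t),
    intervalIntegral.integral_of_le (by linarith), integral_Icc_eq_integral_Ioc]

/-- With `u = -2` and `θ = π x` the argument is `2 + 2 cos (π x)`; on `[0, 1]` it is at least 1
exactly when `x ≤ 2 / 3`, so `log⁺` is `log` up to there and 0 beyond. -/
theorem posLogPotential_two_two :
    posLogPotential 2 2 = ∫ x in (0 : ℝ)..2 / 3, log (2 + 2 * cos (π * x)) := by
  have hc : Continuous fun x => log⁺ (2 + 2 * cos (π * x)) :=
    continuous_posLog.comp (by fun_prop)
  have h1 : posLogPotential 2 2 = ∫ x in (0 : ℝ)..1, log⁺ (2 + 2 * cos (π * x)) := by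
    rw [intervalIntegral.integral_comp_mul_left (fun θ => log⁺ (2 + 2 * cos θ)) pi_ne_zero,
      mul_zero, mul_one, smul_eq_mul, ← posLogPotential_neg, posLogPotential]
    congr! 3 with θ
    rw [← posLog_neg]
    ring_nf
  have hcos : cos (π * (2 / 3)) = -(1 / 2) := by
    rw [show π * (2 / 3) = π - π / 3 by ring, cos_pi_sub, cos_pi_div_three]
  have h2 : ∫ x in (0 : ℝ)..2 / 3, log⁺ (2 + 2 * cos (π * x)) =
      ∫ x in (0 : ℝ)..2 / 3, log (2 + 2 * cos (π * x)) := by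
    refine intervalIntegral.integral_congr fun x hx => posLog_eq_log ?_
    rw [uIcc_of_le (by norm_num)] at hx
    have := cos_le_cos_of_nonneg_of_le_pi (x := π * x) (y := π * (2 / 3))
      (mul_nonneg pi_pos.le hx.1) (by nlinarith [pi_pos]) (by gcongr; exact hx.2)
    rw [hcos] at this
    exact le_trans (by linarith) (le_abs_self _)
  have h3 : ∫ x in (2 / 3 : ℝ)..1, log⁺ (2 + 2 * cos (π * x)) = ∫ x in (2 / 3 : ℝ)..1, (0 : ℝ) := by
    refine intervalIntegral.integral_congr fun x hx => (posLog_eq_zero_iff _).2 ?_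
    rw [uIcc_of_le (by norm_num)] at hx
    have := cos_le_cos_of_nonneg_of_le_pi (x := π * (2 / 3)) (y := π * x)
      (by positivity) (by nlinarith [pi_pos, hx.2]) (by gcongr; exact hx.1)
    rw [hcos] at this
    rw [abs_le]
    constructor <;> linarith [neg_one_le_cos (π * x)]
  rw [h1, ← intervalIntegral.integral_add_adjacent_intervals (b := 2 / 3)
    (hc.intervalIntegrable _ _) (hc.intervalIntegrable _ _), h2, h3]
  simp

end BestConstant

theorem mainTheorem5 :
    (∀ a : ℝ, 0 < a → a ≤ 1 / 2 →
      IsBestFactorConstant (realSegment a) (2 / a)) ∧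
    (∀ a : ℝ, 1 / 2 < a →
      IntervalIntegrable
        (fun t : ℝ => Real.log (t + a) / (Real.pi * Real.sqrt (a ^ 2 - t ^ 2)))
        volume (1 - a) a ∧
      IsBestFactorConstant (realSegment a)
        (2 / a * Real.exp (∫ t in (1 - a)..a,
          Real.log (t + a) / (Real.pi * Real.sqrt (a ^ 2 - t ^ 2))))) ∧
    (∀ a : ℝ, 0 < a →
      (∀ u ∈ Icc (-a) a,
        IntegrableOn (arcsineLogIntegrand a u) (Icc (-a) a \ Ioo (u - 1) (u + 1)) volume) ∧
      IsMaxOn (farLogIntegral a) (Icc (-a) a) (-a) ∧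
      IsMaxOn (farLogIntegral a) (Icc (-a) a) a ∧
      IsBestFactorConstant (realSegment a) (2 / a * Real.exp (farLogIntegral a (-a))) ∧
      IsBestFactorConstant (realSegment a) (2 / a * Real.exp (farLogIntegral a a))) ∧
    (IsBestFactorConstant (realSegment 2)
        (Real.exp (∫ x in (0 : ℝ)..(2 / 3), Real.log (2 + 2 * Real.cos (Real.pi * x)))) ∧
      1.9081 ≤ Real.exp (∫ x in (0 : ℝ)..(2 / 3), Real.log (2 + 2 * Real.cos (Real.pi * x))) ∧
      Real.exp (∫ x in (0 : ℝ)..(2 / 3), Real.log (2 + 2 * Real.cos (Real.pi * x)))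
        < 1.9082) := by
  have best := @isBestFactorConstant_realSegment
  refine ⟨fun a ha ha' => ?_, fun a ha => ⟨intervalIntegrable_log_add_arcsine ha, ?_⟩,
    fun a ha => ⟨fun u _ => integrableOn_arcsineLogIntegrand ha u, fun u hu => ?_, fun u hu => ?_,
      ?_, ?_⟩, ?_, exp_integral_log_two_add_two_mul_cos_bounds⟩
  · have h := best ha
    -- The segment has length `2 a ≤ 1`, so `log⁺` of every distance vanishes.
    rwa [posLogPotential_eq_of_le_one fun θ => ?_, Real.exp_zero, mul_one] at h
    rw [abs_le]
    constructor <;> nlinarith [Real.cos_le_one θ, Real.neg_one_le_cos θ]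
  · rw [integral_log_add_arcsine ha]
    exact best (by linarith)
  · simp only [mem_ofPred_eq, farLogIntegral_eq_posLogPotential ha, posLogPotential_neg]
    exact posLogPotential_le_right ha hu
  · simp only [mem_ofPred_eq, farLogIntegral_eq_posLogPotential ha]
    exact posLogPotential_le_right ha hu
  · rw [farLogIntegral_eq_posLogPotential ha, posLogPotential_neg]
    exact best ha
  · rw [farLogIntegral_eq_posLogPotential ha]
    exact best ha
  · have h := best (a := 2) two_pos
    rwa [posLogPotential_two_two, div_self two_ne_zero, one_mul] at h
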